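/- Let $\mathcal H$ be a nonzero finite-dimensional real or complex inner product space, let $A:\mathcal H\to\mathcal H$ be Hermitian with smallest and largest eigenvalues $\lambda_{\min}$ and $\lambda_{\max}$, and let $\mathcal X,\mathcal Y$ be subspaces of $\mathcal H$ with $\dim\mathcal X=\dim\mathcal Y=m$. Then $$\left|\Lambda(P_{\mathcal X}A|_{\mathcal X})-\Lambda(P_{\mathcal Y}A|_{\mathcal Y})\right|\prec_w(\lambda_{\max}-\lambda_{\min})\,\sin\Theta(\mathcal X,\mathcal Y).$$ Here $P_{\mathcal X}$ is the orthogonal projector onto $\mathcal X$, and $\Lambda(P_{\mathcal X}A|_{\mathcal X})\in\mathbb R^m$ is the vector of Ritz values of $A$ with respect to $\mathcal X$, i.e. the eigenvalues of the operator $P_{\mathcal X}A|_{\mathcal X}:\mathcal X\to\mathcal X$, repeated by multiplicity, in nonincreasing order. The vector of principal angles $\Theta(\mathcal X,\mathcal Y)\in[0,\pi/2]^m$ is defined by $\cos\Theta(\mathcal X,\mathcal Y)=[s_1(P_{\mathcal X}P_{\mathcal Y}),\dots,s_m(P_{\mathcal X}P_{\mathcal Y})]$, where $s_1\ge s_2\ge\cdots$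 are the singular values of $P_{\mathcal X}P_{\mathcal Y}:\mathcal H\to\mathcal H$. Absolute value and sine are taken entrywise, and for $x,y\in\mathbb R^m$, $x\prec_w y$ means $\sum_{i=1}^k x_i^\downarrow\le\sum_{i=1}^k y_i^\downarrow$ for $k=1,\dots,m$, where $x^\downarrow$ is $x$ rearranged in nonincreasing order. -/

import Mathlib

noncomputable section

namespace RitzMajorization

/-- The vector `x↓` obtained by rearranging the entries of `x` in non-increasing order
(sort in non-decreasing order, then reverse). -/
def sortDesc {n : ℕ} (x : Fin n → ℝ) : Fin n → ℝ :=
  fun i => x (Tuple.sort x i.rev)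

/-- Weak (sub)majorization of real vectors of the same length, `x ≺_w y`: every partial sum of
`x↓` is at most the corresponding partial sum of `y↓`. -/
def WeaklyMajorizedBy {n : ℕ} (x y : Fin n → ℝ) : Prop :=
  ∀ k : Fin n, ∑ i ∈ Finset.Iic k, sortDesc x i ≤ ∑ i ∈ Finset.Iic k, sortDesc y i

theorem sortDesc_antitone {n : ℕ} (x : Fin n → ℝ) : Antitone (sortDesc x) := by
  intro i j hij
  exact Tuple.monotone_sort x (Fin.rev_le_rev.mpr hij)

variable {𝕜 : Type*} [RCLike 𝕜] {H : Type*} [NormedAddCommGroup H] [InnerProductSpace 𝕜 H]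
  [FiniteDimensional 𝕜 H]

/-- The operator `P_X A|_X : X → X`, where `P_X` is the orthogonal projector onto `X`. -/
def compression (A : H →ₗ[𝕜] H) (X : Submodule 𝕜 H) : X →ₗ[𝕜] X :=
  (X.orthogonalProjectionOnto : H →ₗ[𝕜] X) ∘ₗ A ∘ₗ X.subtype

theorem compression_isSymmetric {A : H →ₗ[𝕜] H} (hA : A.IsSymmetric) (X : Submodule 𝕜 H) :
    (compression A X).IsSymmetric := by
  intro u v
  simp only [compression, LinearMap.comp_apply, ContinuousLinearMap.coe_coe,
    Submodule.subtype_apply]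
  rw [Submodule.inner_orthogonalProjectionOnto_eq_of_mem_right,
    Submodule.inner_orthogonalProjectionOnto_eq_of_mem_left]
  exact hA u v

/-- The vector `Λ(P_X A|_X)` of Ritz values of the Hermitian operator `A` with respect to the trial
subspace `X` of dimension `m`: the eigenvalues of `P_X A|_X`, repeated according to multiplicity,
in non-increasing order. -/
def ritzValues {A : H →ₗ[𝕜] H} (hA : A.IsSymmetric) (X : Submodule 𝕜 H) {m : ℕ}
    (hX : Module.finrank 𝕜 X = m) : Fin m → ℝ :=
  (compression_isSymmetric hA X).eigenvalues hX

/-- The vector `Θ(X, Y)` of the `m = min {dim X, dim Y}` principal angles between `X` and `Y`,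
in non-decreasing order. Their cosines are the `m` largest singular values of `P_X P_Y`. -/
def principalAngles (X Y : Submodule 𝕜 H) {m : ℕ}
    (_hm : min (Module.finrank 𝕜 X) (Module.finrank 𝕜 Y) = m) : Fin m → ℝ :=
  fun i => Real.arccos
    (LinearMap.singularValues ((X.starProjection ∘L Y.starProjection : H →L[𝕜] H) : H →ₗ[𝕜] H) i)

end RitzMajorization

end

namespace RitzMajorization

open Module RCLike
open scoped InnerProductSpace

variable {𝕜 : Type*} [RCLike 𝕜] {H : Type*} [NormedAddCommGroup H] [InnerProductSpace 𝕜 H]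

/-! ### Operators with a real diagonal in an orthonormal basis. -/

section Diagonal

variable {ι : Type*} [Fintype ι]

/-! Let `E = P_X - P_Y`, with eigenvalues `μ`. For a threshold `t ≥ 0` put `F = (E - t)₊`, so that
`P_X ≤ P_Y + t + F`. If `0 ≤ B² ≤ δ`, congruence by `B` gives `B P_X B ≤ B (P_Y + F) B + t δ`. The
eigenvalues `l` of `B (P_Y + F) B` dominate the Ritz values of `B²` on `Y`, and after adding `t δ`
also those on `X`. Their excess over the values on `Y` has total at most `tr (F B²)`, which bounds
every partial sum of differences (`sum_sub_le_add_re_trace`).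

Absolute values come from using this twice with the same `F`: `B² = A - λ_min` where the difference
is nonnegative, `B² = λ_max - A` where it is negative. The traces add up to `(λ_max - λ_min) tr F`,
with no loss of a factor 2 (`sum_abs_ritzValues_sub_le`).

A dimension count in `X` bounds the first `m` eigenvalues `μ` by the sines in decreasing order
(`sq_singularValues_le`); the rest are nonpositive. Choosing `t` as the last sine in the partial sum
makes `t` cancel. -/

theorem inner_basis_apply {b : OrthonormalBasis ι 𝕜 H} {f : ι → ℝ} {T : H →ₗ[𝕜] H}
    (hT : ∀ i, T (b i) = (f i : 𝕜) • b i) (i : ι) (x : H) :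
    ⟪b i, T x⟫_𝕜 = (f i : 𝕜) * ⟪b i, x⟫_𝕜 := by
  classical
  conv_lhs => rw [← b.sum_repr' x]
  simp only [map_sum, map_smul, hT, inner_sum, inner_smul_right, b.inner_eq_ite]
  simp [mul_comm]

theorem re_inner_apply_self {b : OrthonormalBasis ι 𝕜 H} {f : ι → ℝ} {T : H →ₗ[𝕜] H}
    (hT : ∀ i, T (b i) = (f i : 𝕜) • b i) (x : H) :
    re ⟪T x, x⟫_𝕜 = ∑ i, f i * ‖⟪b i, x⟫_𝕜‖ ^ 2 := by
  rw [← b.sum_inner_mul_inner, map_sum]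
  refine Finset.sum_congr rfl fun i _ => ?_
  rw [← inner_conj_symm, inner_basis_apply hT, map_mul (starRingEnd 𝕜), conj_ofReal, mul_assoc,
    RCLike.conj_mul,
    ← ofReal_pow, ← ofReal_mul, ofReal_re]

theorem isSymmetric_of_apply_basis {b : OrthonormalBasis ι 𝕜 H} {f : ι → ℝ} {T : H →ₗ[𝕜] H}
    (hT : ∀ i, T (b i) = (f i : 𝕜) • b i) : T.IsSymmetric := by
  intro x y
  rw [← b.sum_inner_mul_inner, ← b.sum_inner_mul_inner]
  refine Finset.sum_congr rfl fun i _ => ?_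
  rw [← inner_conj_symm, inner_basis_apply hT, inner_basis_apply hT, map_mul, conj_ofReal,
    inner_conj_symm]
  ring

/-- The operator which is diagonal in the orthonormal basis `b`, with real diagonal `f`. -/
noncomputable def diagonalOperator (b : OrthonormalBasis ι 𝕜 H) (f : ι → ℝ) : H →ₗ[𝕜] H :=
  b.toBasis.constr 𝕜 fun i => (f i : 𝕜) • b i

theorem diagonalOperator_apply_basis (b : OrthonormalBasis ι 𝕜 H) (f : ι → ℝ) (i : ι) :
    diagonalOperator b f (b i) = (f i : 𝕜) • b i := by
  have := b.toBasis.constr_basis 𝕜 (fun i => (f i : 𝕜) • b i) i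
  rwa [b.coe_toBasis] at this

theorem re_trace_diagonalOperator (b : OrthonormalBasis ι 𝕜 H) (f : ι → ℝ) :
    re (LinearMap.trace 𝕜 H (diagonalOperator b f)) = ∑ i, f i := by
  rw [LinearMap.trace_eq_sum_inner _ b, map_sum]
  refine Finset.sum_congr rfl fun i _ => ?_
  rw [diagonalOperator_apply_basis, inner_smul_right, b.inner_eq_one, mul_one, ofReal_re]

theorem inner_eq_zero_of_mem_span {b : OrthonormalBasis ι 𝕜 H} {s : Finset ι} {x : H}
    (hx : x ∈ Submodule.span 𝕜 (b '' s)) {i : ι} (hi : i ∉ s) : ⟪b i, x⟫_𝕜 = 0 := by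
  induction hx using Submodule.span_induction with
  | mem x h =>
    obtain ⟨j, hj, rfl⟩ := h
    exact b.inner_eq_zero fun h => hi (h ▸ hj)
  | zero => simp
  | add x y _ _ hx hy => rw [inner_add_right, hx, hy, add_zero]
  | smul a x _ hx => rw [inner_smul_right, hx, mul_zero]

theorem finrank_span_basis (b : OrthonormalBasis ι 𝕜 H) (s : Finset ι) :
    finrank 𝕜 (Submodule.span 𝕜 (b '' s)) = s.card := by
  have h : LinearIndependent 𝕜 (fun i : s => b i) :=
    b.orthonormal.linearIndependent.comp _ Subtype.val_injective
  have h' := finrank_span_eq_card h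
  rw [Fintype.card_coe] at h'
  have hs : Set.range (fun i : s => b i) = b '' s := by
    ext x
    simp
  rw [← h', hs]

theorem le_re_inner_of_mem_span {b : OrthonormalBasis ι 𝕜 H} {f : ι → ℝ} {T : H →ₗ[𝕜] H}
    (hT : ∀ i, T (b i) = (f i : 𝕜) • b i) {s : Finset ι} {c : ℝ} (hc : ∀ i ∈ s, c ≤ f i) {x : H}
    (hx : x ∈ Submodule.span 𝕜 (b '' s)) : c * ‖x‖ ^ 2 ≤ re ⟪T x, x⟫_𝕜 := by
  rw [re_inner_apply_self hT, ← b.sum_sq_norm_inner_right x, Finset.mul_sum]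
  refine Finset.sum_le_sum fun i _ => ?_
  by_cases hi : i ∈ s
  · exact mul_le_mul_of_nonneg_right (hc i hi) (sq_nonneg _)
  · simp [inner_eq_zero_of_mem_span hx hi]

theorem re_inner_le_of_mem_span {b : OrthonormalBasis ι 𝕜 H} {f : ι → ℝ} {T : H →ₗ[𝕜] H}
    (hT : ∀ i, T (b i) = (f i : 𝕜) • b i) {s : Finset ι} {c : ℝ} (hc : ∀ i ∈ s, f i ≤ c) {x : H}
    (hx : x ∈ Submodule.span 𝕜 (b '' s)) : re ⟪T x, x⟫_𝕜 ≤ c * ‖x‖ ^ 2 := by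
  rw [re_inner_apply_self hT, ← b.sum_sq_norm_inner_right x, Finset.mul_sum]
  refine Finset.sum_le_sum fun i _ => ?_
  by_cases hi : i ∈ s
  · exact mul_le_mul_of_nonneg_right (hc i hi) (sq_nonneg _)
  · simp [inner_eq_zero_of_mem_span hx hi]

theorem mem_span_basis_univ (b : OrthonormalBasis ι 𝕜 H) (x : H) :
    x ∈ Submodule.span 𝕜 (b '' (Finset.univ : Finset ι)) := by
  have := b.toBasis.span_eq
  rw [b.coe_toBasis] at this
  rw [Finset.coe_univ, Set.image_univ, this]
  trivial

end Diagonal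

/-! ### Courant-Fischer and square roots. -/

theorem exists_ne_zero_mem_inf [FiniteDimensional 𝕜 H] {U V W : Submodule 𝕜 H} (hV : V ≤ U)
    (hW : W ≤ U) (h : finrank 𝕜 U < finrank 𝕜 V + finrank 𝕜 W) :
    ∃ x : H, x ∈ V ∧ x ∈ W ∧ x ≠ 0 := by
  by_contra! hcon
  have hbot : V ⊓ W = ⊥ := (Submodule.eq_bot_iff _).2 fun x hx => hcon x hx.1 hx.2
  have h1 := Submodule.finrank_sup_add_finrank_inf_eq V W
  rw [hbot, finrank_bot] at h1
  have h2 := Submodule.finrank_mono (sup_le hV hW)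
  omega

/-- The lower bound in the Courant-Fischer theorem. -/
theorem le_eigenvalues_of_le_re_inner [FiniteDimensional 𝕜 H] {T : H →ₗ[𝕜] H}
    (hT : T.IsSymmetric) {n : ℕ} (hn : finrank 𝕜 H = n) (i : Fin n) {W : Submodule 𝕜 H}
    (hW : (i : ℕ) + 1 ≤ finrank 𝕜 W) {c : ℝ} (hc : ∀ x ∈ W, c * ‖x‖ ^ 2 ≤ re ⟪T x, x⟫_𝕜) :
    c ≤ hT.eigenvalues hn i := by
  obtain ⟨x, hxW, hxV, hx0⟩ : ∃ x : H, x ∈ W ∧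
      x ∈ Submodule.span 𝕜 (hT.eigenvectorBasis hn '' (Finset.Ici i)) ∧ x ≠ 0 := by
    refine exists_ne_zero_mem_inf (U := ⊤) le_top le_top ?_
    rw [finrank_span_basis, finrank_top, hn, Fin.card_Ici]
    have := i.2
    omega
  have h1 := re_inner_le_of_mem_span (hT.apply_eigenvectorBasis hn)
    (c := hT.eigenvalues hn i)
    (fun j hj => hT.eigenvalues_antitone hn (Finset.mem_Ici.1 hj)) hxV
  have h2 := hc x hxW
  have h3 : 0 < ‖x‖ ^ 2 := by positivity
  exact le_of_mul_le_mul_right (h2.trans h1) h3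

/-- A positive semidefinite operator has a symmetric square root. -/
theorem exists_isSymmetric_comp_self_eq [FiniteDimensional 𝕜 H] {T : H →ₗ[𝕜] H}
    (hT : T.IsSymmetric) (h0 : ∀ x, 0 ≤ re ⟪T x, x⟫_𝕜) :
    ∃ B : H →ₗ[𝕜] H, B.IsSymmetric ∧ B ∘ₗ B = T := by
  set b := hT.eigenvectorBasis rfl
  set f := hT.eigenvalues rfl
  have hf : ∀ i, 0 ≤ f i := fun i => by
    have h := h0 (b i)
    rw [hT.apply_eigenvectorBasis rfl i, inner_smul_left, b.inner_eq_one, conj_ofReal, mul_one,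
      ofReal_re] at h
    exact h
  have hB := diagonalOperator_apply_basis b fun i => √(f i)
  refine ⟨diagonalOperator b fun i => √(f i), isSymmetric_of_apply_basis hB, ?_⟩
  refine b.toBasis.ext fun i => ?_
  rw [b.coe_toBasis, LinearMap.comp_apply, hB, map_smul, hB, smul_smul, ← ofReal_mul,
    Real.mul_self_sqrt (hf i)]
  exact (hT.apply_eigenvectorBasis rfl i).symm

/-! ### Lidskii-type comparison under congruence. -/

/-- Comparison of the values of a quadratic form on subspaces of `X` with the eigenvalues of a
congruent operator: if `P_X ≤ t + R` and `B² ≤ δ`, then the values of `B²` on `X` are at most `t δ`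
larger than the eigenvalues of `B R B`. -/
theorem le_add_eigenvalues_comp [FiniteDimensional 𝕜 H] {B R : H →ₗ[𝕜] H} (hB : B.IsSymmetric)
    {δ t : ℝ} (hδ : ∀ x, ‖B x‖ ^ 2 ≤ δ * ‖x‖ ^ 2) (hδ0 : 0 ≤ δ) (ht : 0 ≤ t)
    (X : Submodule 𝕜 H)
    (hR0 : ∀ x, 0 ≤ re ⟪R x, x⟫_𝕜)
    (hR : ∀ x, ‖X.starProjection x‖ ^ 2 ≤ t * ‖x‖ ^ 2 + re ⟪R x, x⟫_𝕜)
    (hG : (B ∘ₗ R ∘ₗ B).IsSymmetric) {n : ℕ} (hn : finrank 𝕜 H = n) (i : Fin n)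
    {W : Submodule 𝕜 H} (hWX : W ≤ X) (hW : finrank 𝕜 W = i + 1) {c : ℝ}
    (hc : ∀ x ∈ W, c * ‖x‖ ^ 2 ≤ ‖B x‖ ^ 2) :
    c ≤ t * δ + hG.eigenvalues hn i := by
  have hGx : ∀ x, re ⟪(B ∘ₗ R ∘ₗ B) x, x⟫_𝕜 = re ⟪R (B x), B x⟫_𝕜 := fun x => by
    rw [LinearMap.comp_apply, LinearMap.comp_apply, hB]
  have htδ : 0 ≤ t * δ := mul_nonneg ht hδ0
  -- For `c ≤ 0` positivity of `B R B` suffices. For `c > 0` the map `B` is injective on `W`, so `B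
  -- W` is a Courant-Fischer test space of dimension `i + 1`.
  by_cases hc0 : c ≤ 0
  · have : 0 ≤ hG.eigenvalues hn i := by
      refine le_eigenvalues_of_le_re_inner hG hn i hW.ge fun x _ => ?_
      rw [zero_mul, hGx]
      exact hR0 _
    linarith
  push Not at hc0
  have hinj : Function.Injective (B ∘ₗ W.subtype) := by
    rw [← LinearMap.ker_eq_bot, LinearMap.ker_eq_bot']
    intro x hx
    have h := hc x x.2
    have hx' : B (x : H) = 0 := hx
    rw [hx', norm_zero] at h
    have : ‖(x : H)‖ ^ 2 = 0 := by
      by_contra hne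
      have : 0 < ‖(x : H)‖ ^ 2 := lt_of_le_of_ne (sq_nonneg _) (Ne.symm hne)
      nlinarith
    simpa using this
  suffices h : c - t * δ ≤ hG.eigenvalues hn i by linarith
  refine le_eigenvalues_of_le_re_inner hG hn i
    (W := LinearMap.range (B ∘ₗ W.subtype)) (by rw [LinearMap.finrank_range_of_inj hinj, hW]) ?_
  rintro _ ⟨⟨x, hx⟩, rfl⟩
  rw [hGx]
  simp only [LinearMap.comp_apply, Submodule.subtype_apply]
  have h1 := hR (B (B x))
  have h2 := hδ (B x)
  have h3 : ‖B x‖ ^ 2 ≤ ‖X.starProjection (B (B x))‖ * ‖x‖ := by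
    rw [← inner_self_eq_norm_sq (𝕜 := 𝕜), ← hB]
    have : ⟪B (B x), x⟫_𝕜 = ⟪X.starProjection (B (B x)), x⟫_𝕜 := by
      rw [Submodule.inner_starProjection_left_eq_right,
        Submodule.starProjection_eq_self_iff.2 (hWX hx)]
    rw [this]
    exact re_inner_le_norm _ _
  have h4 := hc x hx
  -- Square the Cauchy-Schwarz bound `h3` and cancel `‖x‖²`.
  have h5 : c * ‖B x‖ ^ 2 ≤ ‖X.starProjection (B (B x))‖ ^ 2 := by
    rcases (norm_nonneg x).eq_or_lt with h0 | h0
    · rw [norm_eq_zero.1 h0.symm]; simp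
    · have h6 : (‖B x‖ ^ 2) ^ 2 ≤ ‖X.starProjection (B (B x))‖ ^ 2 * ‖x‖ ^ 2 := by
        rw [← mul_pow]; exact pow_le_pow_left₀ (sq_nonneg _) h3 2
      have h7 : c * ‖x‖ ^ 2 * ‖B x‖ ^ 2 ≤ (‖B x‖ ^ 2) ^ 2 := by
        rw [sq (‖B x‖ ^ 2)]
        exact mul_le_mul_of_nonneg_right h4 (sq_nonneg _)
      refine le_of_mul_le_mul_right (a := ‖x‖ ^ 2) ?_ (by positivity)
      linarith
  have h8 := mul_le_mul_of_nonneg_left h2 ht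
  linarith

/-- Lidskii-type estimate: if `P_X ≤ P_Y + t + F` and `B² ≤ δ`, then differences of the values of
the form `B²` on `X` and on `Y` are controlled by `t δ` and the trace of `F B²`. -/
theorem sum_sub_le_add_re_trace [FiniteDimensional 𝕜 H] {B F : H →ₗ[𝕜] H} (hB : B.IsSymmetric)
    {δ t : ℝ} (hδ : ∀ x, ‖B x‖ ^ 2 ≤ δ * ‖x‖ ^ 2) (hδ0 : 0 ≤ δ) (ht : 0 ≤ t)
    {X Y : Submodule 𝕜 H} (hF : F.IsSymmetric) (hF0 : ∀ x, 0 ≤ re ⟪F x, x⟫_𝕜)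
    (hXY : ∀ x, ‖X.starProjection x‖ ^ 2 ≤
      t * ‖x‖ ^ 2 + (‖Y.starProjection x‖ ^ 2 + re ⟪F x, x⟫_𝕜))
    {m : ℕ} (hm : m ≤ finrank 𝕜 H) {a b : Fin m → ℝ}
    (ha : ∀ i : Fin m, ∃ W ≤ X, finrank 𝕜 W = i + 1 ∧ ∀ x ∈ W, a i * ‖x‖ ^ 2 ≤ ‖B x‖ ^ 2)
    (hb : ∀ i : Fin m, ∃ W ≤ Y, finrank 𝕜 W = i + 1 ∧ ∀ x ∈ W, b i * ‖x‖ ^ 2 ≤ ‖B x‖ ^ 2)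
    (hsum : ∑ i, b i =
      re (LinearMap.trace 𝕜 H ((Y.starProjection : H →ₗ[𝕜] H) ∘ₗ (B ∘ₗ B))))
    (I : Finset (Fin m)) :
    ∑ i ∈ I, (a i - b i) ≤ t * δ * I.card + re (LinearMap.trace 𝕜 H (F ∘ₗ (B ∘ₗ B))) := by
  set R : H →ₗ[𝕜] H := (Y.starProjection : H →ₗ[𝕜] H) + F with hRdef
  have hRx : ∀ x, re ⟪R x, x⟫_𝕜 = ‖Y.starProjection x‖ ^ 2 + re ⟪F x, x⟫_𝕜 := fun x => by
    rw [hRdef, LinearMap.add_apply, inner_add_left, map_add]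
    congr 1
    exact Y.re_inner_starProjection_eq_normSq x
  have hRsymm : R.IsSymmetric := Y.starProjection_isSymmetric.add hF
  have hR0 : ∀ x, 0 ≤ re ⟪R x, x⟫_𝕜 := fun x => by
    rw [hRx]
    exact add_nonneg (sq_nonneg _) (hF0 x)
  have hG : (B ∘ₗ R ∘ₗ B).IsSymmetric := fun x y => by
    simp only [LinearMap.comp_apply]
    rw [hB, hRsymm, hB]
  set l := hG.eigenvalues rfl with hl
  have hal : ∀ i : Fin m, a i ≤ t * δ + l (Fin.castLE hm i) := fun i => by
    obtain ⟨W, hWX, hW, h⟩ := ha i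
    exact le_add_eigenvalues_comp hB hδ hδ0 ht X hR0 (fun x => by rw [hRx]; exact hXY x) hG rfl
      (Fin.castLE hm i) hWX hW h
  have hbl : ∀ i : Fin m, b i ≤ l (Fin.castLE hm i) := fun i => by
    obtain ⟨W, hWY, hW, h⟩ := hb i
    -- On `Y` no shift is needed: `P_Y ≤ R`, so the comparison applies with `t = 0`.
    have := le_add_eigenvalues_comp hB hδ hδ0 le_rfl Y hR0
      (fun x => by rw [hRx]; linarith [hF0 x]) hG rfl (Fin.castLE hm i) hWY hW h
    linarith
  have hl0 : ∀ i, 0 ≤ l i := fun i => by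
    refine le_eigenvalues_of_le_re_inner hG rfl i (W := ⊤) ?_ fun x _ => ?_
    · rw [finrank_top]; exact i.2
    · rw [zero_mul, LinearMap.comp_apply, LinearMap.comp_apply, hB]
      exact hR0 _
  have htr : ∑ i, l i = ∑ i, b i + re (LinearMap.trace 𝕜 H (F ∘ₗ (B ∘ₗ B))) := by
    rw [hsum, hl, ← hG.re_trace_eq_sum_eigenvalues rfl, ← map_add, ← map_add, ← LinearMap.add_comp,
      ← hRdef, LinearMap.trace_comp_comm', LinearMap.comp_assoc]
  have hle : ∑ i : Fin m, l (Fin.castLE hm i) ≤ ∑ i, l i := by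
    refine (Finset.sum_map Finset.univ (Fin.castLEEmb hm) l).symm.trans_le ?_
    exact Finset.sum_le_sum_of_subset_of_nonneg (Finset.subset_univ _) fun i _ _ => hl0 i
  calc ∑ i ∈ I, (a i - b i) ≤ ∑ i ∈ I, (t * δ + (l (Fin.castLE hm i) - b i)) :=
        Finset.sum_le_sum fun i _ => by linarith [hal i]
    _ = t * δ * I.card + ∑ i ∈ I, (l (Fin.castLE hm i) - b i) := by
        rw [Finset.sum_add_distrib, Finset.sum_const, nsmul_eq_mul, mul_comm]
    -- Every `l i - b i` is nonnegative, so `I` may be enlarged to all indices, where the trace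
    -- identity applies.
    _ ≤ t * δ * I.card + ∑ i, (l (Fin.castLE hm i) - b i) := by
        gcongr
        · intro i _ _
          linarith [hbl i]
        · exact Finset.subset_univ I
    _ ≤ _ := by
        rw [Finset.sum_sub_distrib]
        linarith

/-! ### Quadratic forms and traces of compressions. -/

theorem exists_submodule_le_re_inner [FiniteDimensional 𝕜 H] {A : H →ₗ[𝕜] H} {X : Submodule 𝕜 H}
    {m : ℕ} {v : OrthonormalBasis (Fin m) 𝕜 X} {f : Fin m → ℝ}
    (hv : ∀ i, compression A X (v i) = (f i : 𝕜) • v i) {s : Finset (Fin m)} {c : ℝ}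
    (hc : ∀ i ∈ s, c ≤ f i) :
    ∃ W ≤ X, finrank 𝕜 W = s.card ∧ ∀ x ∈ W, c * ‖x‖ ^ 2 ≤ re ⟪A x, x⟫_𝕜 := by
  refine ⟨(Submodule.span 𝕜 (v '' s)).map X.subtype, Submodule.map_subtype_le _ _, ?_, ?_⟩
  · rw [Submodule.finrank_map_subtype_eq, finrank_span_basis]
  · rintro _ ⟨x, hx, rfl⟩
    have h := le_re_inner_of_mem_span hv hc hx
    rwa [compression, LinearMap.comp_apply, LinearMap.comp_apply, ContinuousLinearMap.coe_coe,
      Submodule.inner_orthogonalProjectionOnto_eq_of_mem_right] at h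

theorem trace_starProjection_comp [FiniteDimensional 𝕜 H] (A : H →ₗ[𝕜] H) (Y : Submodule 𝕜 H) :
    LinearMap.trace 𝕜 H ((Y.starProjection : H →ₗ[𝕜] H) ∘ₗ A) =
      LinearMap.trace 𝕜 Y (compression A Y) := by
  have h : (Y.starProjection : H →ₗ[𝕜] H) ∘ₗ A =
      Y.subtype ∘ₗ ((Y.orthogonalProjectionOnto : H →ₗ[𝕜] Y) ∘ₗ A) := rfl
  rw [h, LinearMap.trace_comp_comm', compression, LinearMap.comp_assoc]

theorem trace_starProjection [FiniteDimensional 𝕜 H] (Y : Submodule 𝕜 H) :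
    LinearMap.trace 𝕜 H (Y.starProjection : H →ₗ[𝕜] H) = finrank 𝕜 Y := by
  have h := trace_starProjection_comp LinearMap.id Y
  have h1 : compression LinearMap.id Y = LinearMap.id := by
    ext x
    simp [compression]
  rwa [LinearMap.comp_id, h1, LinearMap.trace_id] at h

/-- The difference of the orthogonal projectors onto two subspaces. -/
noncomputable def projectionDifference [FiniteDimensional 𝕜 H] (X Y : Submodule 𝕜 H) : H →ₗ[𝕜] H :=
  (X.starProjection : H →ₗ[𝕜] H) - Y.starProjection

/-! ### Spectrum of `P_X - P_Y` and principal angles. -/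

section ProjectionDifference

variable [FiniteDimensional 𝕜 H] (X Y : Submodule 𝕜 H)

theorem projectionDifference_apply (x : H) :
    projectionDifference X Y x = X.starProjection x - Y.starProjection x := rfl

theorem projectionDifference_isSymmetric : (projectionDifference X Y).IsSymmetric :=
  X.starProjection_isSymmetric.sub Y.starProjection_isSymmetric

theorem re_inner_projectionDifference (x : H) :
    re ⟪projectionDifference X Y x, x⟫_𝕜 =
      ‖X.starProjection x‖ ^ 2 - ‖Y.starProjection x‖ ^ 2 := by
  rw [projectionDifference_apply, inner_sub_left, map_sub,
    X.re_inner_starProjection_eq_normSq, Y.re_inner_starProjection_eq_normSq]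
  rfl

theorem starProjection_starProjection (x : H) :
    X.starProjection (X.starProjection x) = X.starProjection x :=
  Submodule.starProjection_eq_self_iff.2 (X.starProjection_apply_mem x)

/-- Both sides expand to `P_X - P_X P_Y P_X`. Hence `P_X` preserves the eigenspaces of `E²`, though
not those of `E`. -/
theorem projectionDifference_sq_starProjection (x : H) :
    projectionDifference X Y (projectionDifference X Y (X.starProjection x)) =
      X.starProjection (projectionDifference X Y (projectionDifference X Y x)) := by
  simp only [projectionDifference_apply, map_sub, starProjection_starProjection]
  abel

/-- On `X` the operator `E` acts as the projector onto `Yᗮ`, so this is Pythagoras. -/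
theorem norm_sq_starProjection_add_re_inner {u : H} (hu : u ∈ X) :
    ‖Y.starProjection u‖ ^ 2 +
      re ⟪projectionDifference X Y (projectionDifference X Y u), u⟫_𝕜 = ‖u‖ ^ 2 := by
  rw [projectionDifference_isSymmetric, inner_self_eq_norm_sq, projectionDifference_apply,
    Submodule.starProjection_eq_self_iff.2 hu, Y.norm_sq_eq_add_norm_sq_starProjection u,
    Y.starProjection_orthogonal_val]

variable {n : ℕ} (hn : finrank 𝕜 H = n)

/-- The form of `E` is nonpositive on `Xᗮ`, which meets the span of the first `j + 1` eigenvectors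
once `j ≥ dim X`. -/
theorem eigenvalues_projectionDifference_nonpos {j : Fin n} (hj : finrank 𝕜 X ≤ j) :
    (projectionDifference_isSymmetric X Y).eigenvalues hn j ≤ 0 := by
  set hE := projectionDifference_isSymmetric X Y
  obtain ⟨x, hx, hxX, hx0⟩ : ∃ x : H, x ∈ Submodule.span 𝕜
      (hE.eigenvectorBasis hn '' (Finset.Iic j)) ∧ x ∈ Xᗮ ∧ x ≠ 0 := by
    refine exists_ne_zero_mem_inf (U := ⊤) le_top le_top ?_
    have := X.finrank_add_finrank_orthogonal
    rw [finrank_span_basis, finrank_top, Fin.card_Iic]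
    omega
  have h1 := le_re_inner_of_mem_span (hE.apply_eigenvectorBasis hn)
    (c := hE.eigenvalues hn j)
    (fun i hi => hE.eigenvalues_antitone hn (Finset.mem_Iic.1 hi)) hx
  rw [re_inner_projectionDifference, X.starProjection_apply_eq_zero_iff.2 hxX, norm_zero] at h1
  have h3 : 0 < ‖x‖ ^ 2 := by positivity
  refine le_of_mul_le_mul_right (a := ‖x‖ ^ 2) ?_ h3
  nlinarith [sq_nonneg ‖Y.starProjection x‖]

/-- Since `P_X` commutes with `E²`, the vector `P_X x` stays in the eigenspaces of `E²` with
eigenvalue at least `μ j ^ 2`; Pythagoras on `X` then bounds its projection to `Y`. -/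
theorem sq_eigenvalue_mul_le {j : Fin n}
    (hj : 0 < (projectionDifference_isSymmetric X Y).eigenvalues hn j) {x : H}
    (hx : x ∈ Submodule.span 𝕜
      ((projectionDifference_isSymmetric X Y).eigenvectorBasis hn '' (Finset.Iic j))) :
    ‖Y.starProjection (X.starProjection x)‖ ^ 2 ≤
      (1 - (projectionDifference_isSymmetric X Y).eigenvalues hn j ^ 2) *
        ‖X.starProjection x‖ ^ 2 := by
  classical
  set hE := projectionDifference_isSymmetric X Y
  set e := hE.eigenvectorBasis hn
  set μ := hE.eigenvalues hn
  have he : ∀ i, (projectionDifference X Y ∘ₗ projectionDifference X Y) (e i) =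
      ((μ i ^ 2 : ℝ) : 𝕜) • e i := fun i => by
    have h : projectionDifference X Y (e i) = (μ i : 𝕜) • e i := hE.apply_eigenvectorBasis hn i
    rw [LinearMap.comp_apply, h, map_smul, h, smul_smul, ← ofReal_mul, sq]
  have horth : ∀ i, μ i ^ 2 < μ j ^ 2 → ⟪e i, X.starProjection x⟫_𝕜 = 0 := by
    intro i hi
    induction hx using Submodule.span_induction with
    | mem x h =>
      obtain ⟨l, hl, rfl⟩ := h
      have hlj : μ j ≤ μ l := hE.eigenvalues_antitone hn (by simpa using hl)
      have h1 := inner_basis_apply he i (X.starProjection (e l))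
      rw [LinearMap.comp_apply, projectionDifference_sq_starProjection] at h1
      have h2 := he l
      rw [LinearMap.comp_apply] at h2
      rw [h2, map_smul, inner_smul_right] at h1
      have hne : ((μ l ^ 2 : ℝ) : 𝕜) - ((μ i ^ 2 : ℝ) : 𝕜) ≠ 0 := by
        rw [← ofReal_sub, Ne, ofReal_eq_zero]
        nlinarith
      refine (mul_eq_zero.1 ?_).resolve_left hne
      rw [sub_mul, h1, sub_self]
    | zero => simp
    | add x y _ _ hx hy => rw [map_add, inner_add_right, hx, hy, add_zero]
    | smul a x _ hx => rw [map_smul, inner_smul_right, hx, mul_zero]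
  have hmem : X.starProjection x ∈ Submodule.span 𝕜
      (e '' (Finset.univ.filter fun i => μ j ^ 2 ≤ μ i ^ 2 : Finset (Fin n))) := by
    rw [← e.sum_repr' (X.starProjection x)]
    refine Submodule.sum_mem _ fun i _ => ?_
    by_cases hi : μ j ^ 2 ≤ μ i ^ 2
    · exact Submodule.smul_mem _ _ (Submodule.subset_span ⟨i, by simpa using hi, rfl⟩)
    · rw [horth i (not_le.1 hi), zero_smul]
      exact zero_mem _
  have h1 := le_re_inner_of_mem_span he (c := μ j ^ 2) (by simp) hmem
  have h2 := norm_sq_starProjection_add_re_inner X Y (X.starProjection_apply_mem x)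
  rw [LinearMap.comp_apply] at h1
  linarith

/-- The positive eigenvalues of `P_X - P_Y` are bounded by the sines of the principal angles. -/
theorem sq_singularValues_le {j : Fin n}
    (hj : 0 < (projectionDifference_isSymmetric X Y).eigenvalues hn j) {i : ℕ}
    (hij : i + j + 1 = finrank 𝕜 X) :
    (LinearMap.singularValues
      ((X.starProjection ∘L Y.starProjection : H →L[𝕜] H) : H →ₗ[𝕜] H) i) ^ 2 ≤
      1 - (projectionDifference_isSymmetric X Y).eigenvalues hn j ^ 2 := by
  set hE := projectionDifference_isSymmetric X Y
  set e := hE.eigenvectorBasis hn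
  set μ := hE.eigenvalues hn
  set T : H →ₗ[𝕜] H := ((X.starProjection ∘L Y.starProjection : H →L[𝕜] H) : H →ₗ[𝕜] H)
  have hTx : ∀ x, T x = X.starProjection (Y.starProjection x) := fun x => rfl
  set W := Submodule.span 𝕜 (e '' (Finset.Iic j))
  have hWx : ∀ x ∈ W, μ j * ‖x‖ ^ 2 ≤ ‖X.starProjection x‖ ^ 2 - ‖Y.starProjection x‖ ^ 2 := by
    intro x hx
    rw [← re_inner_projectionDifference]
    exact le_re_inner_of_mem_span (hE.apply_eigenvectorBasis hn)
      (fun i hi => hE.eigenvalues_antitone hn (Finset.mem_Iic.1 hi)) hx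
  have hWinj : Function.Injective ((X.starProjection : H →ₗ[𝕜] H) ∘ₗ W.subtype) := by
    rw [← LinearMap.ker_eq_bot, LinearMap.ker_eq_bot']
    intro x hx
    have hx' : X.starProjection (x : H) = 0 := hx
    have h := hWx x x.2
    rw [hx', norm_zero] at h
    by_contra hne
    have : 0 < ‖(x : H)‖ := norm_pos_iff.2 (by simpa using hne)
    have := mul_pos hj (pow_pos this 2)
    nlinarith [sq_nonneg ‖Y.starProjection (x : H)‖]
  have hWrange : finrank 𝕜 (LinearMap.range ((X.starProjection : H →ₗ[𝕜] H) ∘ₗ W.subtype)) =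
      j + 1 := by
    rw [LinearMap.finrank_range_of_inj hWinj, finrank_span_basis, Fin.card_Iic]
  -- A zero singular value would break injectivity of `T` on `V`; in that case only `μ j ≤ 1` is
  -- needed.
  rcases (T.singularValues_nonneg i).eq_or_lt with hs | hs
  · rw [← hs]
    have he : e j ∈ W := Submodule.subset_span ⟨j, by simp, rfl⟩
    have h1 := hWx _ he
    have h2 := X.norm_starProjection_apply_le (e j)
    rw [e.norm_eq_one] at h1 h2
    have h3 := norm_nonneg (X.starProjection (e j))
    have h4 : μ j ≤ 1 := by nlinarith [sq_nonneg ‖Y.starProjection (e j)‖]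
    nlinarith
  have hin : i < n := by
    have := X.finrank_le
    omega
  set g := T.isSymmetric_adjoint_comp_self.eigenvectorBasis hn
  set V := Submodule.span 𝕜 (g '' (Finset.Iic (⟨i, hin⟩ : Fin n)))
  have hVx : ∀ y ∈ V, T.singularValues i ^ 2 * ‖y‖ ^ 2 ≤ ‖T y‖ ^ 2 := by
    intro y hy
    rw [T.sq_singularValues_of_lt hn hin]
    have h := le_re_inner_of_mem_span (T.isSymmetric_adjoint_comp_self.apply_eigenvectorBasis hn)
      (fun k hk => T.isSymmetric_adjoint_comp_self.eigenvalues_antitone hn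
        (Finset.mem_Iic.1 hk)) hy
    rwa [LinearMap.comp_apply, LinearMap.adjoint_inner_left, inner_self_eq_norm_sq] at h
  have hVinj : Function.Injective (T ∘ₗ V.subtype) := by
    rw [← LinearMap.ker_eq_bot, LinearMap.ker_eq_bot']
    intro x hx
    have hx' : T (x : H) = 0 := hx
    have h := hVx x x.2
    rw [hx', norm_zero] at h
    by_contra hne
    have : 0 < ‖(x : H)‖ := norm_pos_iff.2 (by simpa using hne)
    have := mul_pos (pow_pos hs 2) (pow_pos this 2)
    linarith
  have hVrange : finrank 𝕜 (LinearMap.range (T ∘ₗ V.subtype)) = i + 1 := by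
    rw [LinearMap.finrank_range_of_inj hVinj, finrank_span_basis, Fin.card_Iic]
  -- Both ranges lie in `X`, and `(j + 1) + (i + 1)` exceeds `dim X` by one.
  obtain ⟨u, ⟨⟨x, hx⟩, hxu⟩, ⟨⟨y, hy⟩, hyu⟩, hu0⟩ := exists_ne_zero_mem_inf (U := X)
    (V := LinearMap.range ((X.starProjection : H →ₗ[𝕜] H) ∘ₗ W.subtype))
    (W := LinearMap.range (T ∘ₗ V.subtype))
    (by rintro _ ⟨x, rfl⟩; exact X.starProjection_apply_mem _)
    (by rintro _ ⟨x, rfl⟩; exact X.starProjection_apply_mem _)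
    (by omega)
  replace hxu : X.starProjection x = u := hxu
  replace hyu : X.starProjection (Y.starProjection y) = u := hyu
  have h1 := sq_eigenvalue_mul_le X Y hn hj hx
  rw [hxu] at h1
  have h2 := hVx y hy
  rw [hTx, hyu] at h2
  have h3 : ‖u‖ ^ 2 ≤ ‖Y.starProjection u‖ * ‖y‖ := by
    have hu : X.starProjection u = u := by rw [← hxu, starProjection_starProjection]
    have : ⟪u, u⟫_𝕜 = ⟪Y.starProjection u, y⟫_𝕜 := by
      conv_lhs => rw [← hyu, ← Submodule.inner_starProjection_left_eq_right, hyu, hu]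
      rw [← Submodule.inner_starProjection_left_eq_right]
    rw [← inner_self_eq_norm_sq (𝕜 := 𝕜), this]
    exact re_inner_le_norm _ _
  have hu : 0 < ‖u‖ ^ 2 := by positivity
  have h4 : 0 ≤ 1 - μ j ^ 2 := by
    by_contra! hneg
    nlinarith [sq_nonneg ‖Y.starProjection u‖]
  have h5 : (‖u‖ ^ 2) ^ 2 ≤ (1 - μ j ^ 2) * ‖u‖ ^ 2 * ‖y‖ ^ 2 := by
    calc (‖u‖ ^ 2) ^ 2 ≤ (‖Y.starProjection u‖ * ‖y‖) ^ 2 := pow_le_pow_left₀ hu.le h3 2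
      _ = ‖Y.starProjection u‖ ^ 2 * ‖y‖ ^ 2 := mul_pow _ _ _
      _ ≤ _ := mul_le_mul_of_nonneg_right h1 (sq_nonneg _)
  have h6 : ‖u‖ ^ 2 ≤ (1 - μ j ^ 2) * ‖y‖ ^ 2 := by
    refine le_of_mul_le_mul_right (a := ‖u‖ ^ 2) ?_ hu
    linarith
  have h7 := mul_le_mul_of_nonneg_left h6 (sq_nonneg (T.singularValues i))
  have h8 := mul_le_mul_of_nonneg_left h2 h4
  refine le_of_mul_le_mul_right (a := ‖u‖ ^ 2) ?_ hu
  linarith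

end ProjectionDifference

/-! ### Ritz values of shifted and reflected operators. -/

theorem re_inner_affine (A : H →ₗ[𝕜] H) (r s : ℝ) (x : H) :
    re ⟪((r : 𝕜) • LinearMap.id + (s : 𝕜) • A : H →ₗ[𝕜] H) x, x⟫_𝕜 = r * ‖x‖ ^ 2 + s * re ⟪A x, x⟫_𝕜 := by
  rw [LinearMap.add_apply, LinearMap.smul_apply, LinearMap.smul_apply, LinearMap.id_apply,
    inner_add_left, inner_smul_left, inner_smul_left, conj_ofReal, conj_ofReal, map_add,
    re_ofReal_mul, re_ofReal_mul, inner_self_eq_norm_sq]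

theorem re_trace_comp_affine (A F : H →ₗ[𝕜] H) (r s : ℝ) :
    re (LinearMap.trace 𝕜 H (F ∘ₗ ((r : 𝕜) • LinearMap.id + (s : 𝕜) • A))) =
      r * re (LinearMap.trace 𝕜 H F) + s * re (LinearMap.trace 𝕜 H (F ∘ₗ A)) := by
  rw [LinearMap.comp_add, LinearMap.comp_smul, LinearMap.comp_smul, LinearMap.comp_id, map_add,
    map_smul, map_smul, map_add, smul_eq_mul, smul_eq_mul, re_ofReal_mul, re_ofReal_mul]

variable [FiniteDimensional 𝕜 H]

theorem compression_affine_apply {A : H →ₗ[𝕜] H} {X : Submodule 𝕜 H} {x : X} {c : ℝ}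
    (hx : compression A X x = (c : 𝕜) • x) (r s : ℝ) :
    compression ((r : 𝕜) • LinearMap.id + (s : 𝕜) • A) X x = ((r + s * c : ℝ) : 𝕜) • x := by
  have h : compression ((r : 𝕜) • LinearMap.id + (s : 𝕜) • A) X x =
      (r : 𝕜) • x + (s : 𝕜) • compression A X x := by
    simp [compression]
  rw [h, hx, smul_smul, ← add_smul]
  push_cast
  rfl

/-- One-sided estimate for the Ritz values of `r + s A`, where `0 ≤ r + s A ≤ δ`. -/
theorem sum_mul_ritzValues_sub_le {A : H →ₗ[𝕜] H} (hA : A.IsSymmetric) {X Y : Submodule 𝕜 H} {m : ℕ}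
    (hX : finrank 𝕜 X = m) (hY : finrank 𝕜 Y = m) {δ t r s : ℝ} (ht : 0 ≤ t) (hδ0 : 0 ≤ δ)
    (h0 : ∀ x, 0 ≤ r * ‖x‖ ^ 2 + s * re ⟪A x, x⟫_𝕜)
    (hδ : ∀ x, r * ‖x‖ ^ 2 + s * re ⟪A x, x⟫_𝕜 ≤ δ * ‖x‖ ^ 2)
    {F : H →ₗ[𝕜] H} (hF : F.IsSymmetric) (hF0 : ∀ x, 0 ≤ re ⟪F x, x⟫_𝕜)
    (hXY : ∀ x, ‖X.starProjection x‖ ^ 2 ≤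
      t * ‖x‖ ^ 2 + (‖Y.starProjection x‖ ^ 2 + re ⟪F x, x⟫_𝕜))
    (π : Equiv.Perm (Fin m)) (hπX : Antitone fun i => r + s * ritzValues hA X hX (π i))
    (hπY : Antitone fun i => r + s * ritzValues hA Y hY (π i)) (I : Finset (Fin m)) :
    ∑ i ∈ I, s * (ritzValues hA X hX i - ritzValues hA Y hY i) ≤
      t * δ * I.card +
        (r * re (LinearMap.trace 𝕜 H F) + s * re (LinearMap.trace 𝕜 H (F ∘ₗ A))) := by
  have hA' : ((r : 𝕜) • LinearMap.id + (s : 𝕜) • A : H →ₗ[𝕜] H).IsSymmetric := by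
    intro x y
    simp only [LinearMap.add_apply, LinearMap.smul_apply, LinearMap.id_apply, inner_add_left,
      inner_add_right, inner_smul_left, inner_smul_right, conj_ofReal, hA x y]
  obtain ⟨B, hB, hBA⟩ := exists_isSymmetric_comp_self_eq hA' fun x => by
    rw [re_inner_affine]
    exact h0 x
  have hBx : ∀ x, ‖B x‖ ^ 2 = r * ‖x‖ ^ 2 + s * re ⟪A x, x⟫_𝕜 := fun x => by
    rw [← re_inner_affine, ← hBA, LinearMap.comp_apply, hB, inner_self_eq_norm_sq]
  -- Reindexing by `π` puts the values of `r + s A` in nonincreasing order even when `s < 0`.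
  have key : ∀ (Z : Submodule 𝕜 H) (hZ : finrank 𝕜 Z = m),
      (Antitone fun i => r + s * ritzValues hA Z hZ (π i)) → ∀ i : Fin m, ∃ W ≤ Z,
        finrank 𝕜 W = i + 1 ∧
          ∀ x ∈ W, (r + s * ritzValues hA Z hZ (π i)) * ‖x‖ ^ 2 ≤ ‖B x‖ ^ 2 := by
    intro Z hZ hanti i
    obtain ⟨W, hWZ, hW, h⟩ := exists_submodule_le_re_inner
      (A := (r : 𝕜) • LinearMap.id + (s : 𝕜) • A)
      (fun l => compression_affine_apply
        ((compression_isSymmetric hA Z).apply_eigenvectorBasis hZ l) r s)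
      (s := (Finset.Iic i).map π.toEmbedding) (c := r + s * ritzValues hA Z hZ (π i)) (by
        intro l hl
        obtain ⟨l', hl', rfl⟩ := Finset.mem_map.1 hl
        exact hanti (Finset.mem_Iic.1 hl'))
    refine ⟨W, hWZ, by rw [hW, Finset.card_map, Fin.card_Iic], fun x hx => ?_⟩
    rw [hBx, ← re_inner_affine]
    exact h x hx
  have hsum : ∑ i, (r + s * ritzValues hA Y hY (π i)) =
      re (LinearMap.trace 𝕜 H ((Y.starProjection : H →ₗ[𝕜] H) ∘ₗ (B ∘ₗ B))) := by
    rw [hBA, re_trace_comp_affine, trace_starProjection, trace_starProjection_comp,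
      (compression_isSymmetric hA Y).re_trace_eq_sum_eigenvalues hY,
      Equiv.sum_comp π (fun i => r + s * ritzValues hA Y hY i), Finset.sum_add_distrib,
      ← Finset.mul_sum, hY, natCast_re]
    simp [ritzValues, mul_comm]
  have h := sum_sub_le_add_re_trace hB (fun x => by rw [hBx]; exact hδ x) hδ0 ht hF hF0 hXY
    (hX ▸ X.finrank_le) (key X hX hπX) (key Y hY hπY) hsum (I.map π.symm.toEmbedding)
  rw [hBA, re_trace_comp_affine, Finset.card_map, Finset.sum_map] at h
  refine le_trans (le_of_eq (Finset.sum_congr rfl fun i _ => ?_)) h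
  simp only [Equiv.coe_toEmbedding, Equiv.apply_symm_apply]
  ring

/-- The sum of absolute changes in Ritz values in terms of the eigenvalues of `P_X - P_Y`. -/
theorem sum_abs_ritzValues_sub_le {A : H →ₗ[𝕜] H} (hA : A.IsSymmetric) {X Y : Submodule 𝕜 H} {m : ℕ}
    (hX : finrank 𝕜 X = m) (hY : finrank 𝕜 Y = m) {l u t : ℝ} (ht : 0 ≤ t) (hlu : l ≤ u)
    (hl : ∀ x, l * ‖x‖ ^ 2 ≤ re ⟪A x, x⟫_𝕜) (hu : ∀ x, re ⟪A x, x⟫_𝕜 ≤ u * ‖x‖ ^ 2)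
    (J : Finset (Fin m)) :
    ∑ i ∈ J, |ritzValues hA X hX i - ritzValues hA Y hY i| ≤
      (u - l) * (t * J.card +
        ∑ i, max ((projectionDifference_isSymmetric X Y).eigenvalues rfl i - t) 0) := by
  set hE := projectionDifference_isSymmetric X Y
  set e := hE.eigenvectorBasis rfl
  set μ := hE.eigenvalues rfl
  set F := diagonalOperator e fun i => max (μ i - t) 0
  have hFe := diagonalOperator_apply_basis e fun i => max (μ i - t) 0
  have hF0 : ∀ x, 0 ≤ re ⟪F x, x⟫_𝕜 := fun x => by
    rw [re_inner_apply_self hFe]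
    exact Finset.sum_nonneg fun i _ => mul_nonneg (le_max_right _ _) (sq_nonneg _)
  have hXY : ∀ x, ‖X.starProjection x‖ ^ 2 ≤
      t * ‖x‖ ^ 2 + (‖Y.starProjection x‖ ^ 2 + re ⟪F x, x⟫_𝕜) := fun x => by
    have h1 := re_inner_projectionDifference X Y x
    rw [re_inner_apply_self (hE.apply_eigenvectorBasis rfl)] at h1
    have h2 : ∑ i, μ i * ‖⟪e i, x⟫_𝕜‖ ^ 2 ≤ t * ‖x‖ ^ 2 + re ⟪F x, x⟫_𝕜 := by
      rw [re_inner_apply_self hFe, ← e.sum_sq_norm_inner_right x, Finset.mul_sum,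
        ← Finset.sum_add_distrib]
      refine Finset.sum_le_sum fun i _ => ?_
      rw [← add_mul]
      refine mul_le_mul_of_nonneg_right ?_ (sq_nonneg _)
      linarith [le_max_left (μ i - t) 0]
    linarith
  have hF := isSymmetric_of_apply_basis hFe
  have hanti : ∀ (Z : Submodule 𝕜 H) (hZ : finrank 𝕜 Z = m), Antitone (ritzValues hA Z hZ) :=
    fun Z hZ => (compression_isSymmetric hA Z).eigenvalues_antitone hZ
  have hrev : ∀ (Z : Submodule 𝕜 H) (hZ : finrank 𝕜 Z = m),
      Antitone fun i => u + -1 * ritzValues hA Z hZ (Fin.revPerm i) := fun Z hZ i j hij => by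
    have := hanti Z hZ (Fin.rev_le_rev.2 hij)
    simp only [Fin.revPerm_apply]
    linarith
  have hpos := sum_mul_ritzValues_sub_le hA hX hY (δ := u - l) (r := -l) (s := 1) ht
    (sub_nonneg.2 hlu) (fun x => by linarith [hl x]) (fun x => by linarith [hu x]) hF hF0 hXY
    (Equiv.refl _) (fun i j hij => by simpa using hanti X hX hij)
    (fun i j hij => by simpa using hanti Y hY hij)
    (J.filter fun i => 0 ≤ ritzValues hA X hX i - ritzValues hA Y hY i)
  -- Reflecting `A`, rather than exchanging `X` and `Y`, keeps the same `F`.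
  have hneg := sum_mul_ritzValues_sub_le hA hX hY (δ := u - l) (r := u) (s := -1) ht
    (sub_nonneg.2 hlu) (fun x => by linarith [hu x]) (fun x => by linarith [hl x]) hF hF0 hXY
    Fin.revPerm (hrev X hX) (hrev Y hY)
    (J.filter fun i => ¬ 0 ≤ ritzValues hA X hX i - ritzValues hA Y hY i)
  have hcard := Finset.card_filter_add_card_filter_not (s := J)
    (fun i => 0 ≤ ritzValues hA X hX i - ritzValues hA Y hY i)
  rw [← Finset.sum_filter_add_sum_filter_not J
    (fun i => 0 ≤ ritzValues hA X hX i - ritzValues hA Y hY i), ← hcard,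
    ← re_trace_diagonalOperator e fun i => max (μ i - t) 0]
  have e1 : ∑ i ∈ J.filter (fun i => 0 ≤ ritzValues hA X hX i - ritzValues hA Y hY i),
      |ritzValues hA X hX i - ritzValues hA Y hY i| =
      ∑ i ∈ J.filter (fun i => 0 ≤ ritzValues hA X hX i - ritzValues hA Y hY i),
        1 * (ritzValues hA X hX i - ritzValues hA Y hY i) :=
    Finset.sum_congr rfl fun i hi => by rw [abs_of_nonneg (Finset.mem_filter.1 hi).2, one_mul]
  have e2 : ∑ i ∈ J.filter (fun i => ¬ 0 ≤ ritzValues hA X hX i - ritzValues hA Y hY i),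
      |ritzValues hA X hX i - ritzValues hA Y hY i| =
      ∑ i ∈ J.filter (fun i => ¬ 0 ≤ ritzValues hA X hX i - ritzValues hA Y hY i),
        -1 * (ritzValues hA X hX i - ritzValues hA Y hY i) :=
    Finset.sum_congr rfl fun i hi => by
      rw [abs_of_neg (not_le.1 (Finset.mem_filter.1 hi).2), neg_one_mul]
  rw [e1, e2]
  refine (add_le_add hpos hneg).trans (le_of_eq ?_)
  push_cast
  ring

/-! ### From eigenvalues to sines, and the conclusion. -/

/-- The eigenvalues of `P_X - P_Y` above a sine of a principal angle are dominated by the larger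
sines. -/
theorem sum_max_eigenvalues_sub_le (X Y : Submodule 𝕜 H) {m : ℕ} (hX : finrank 𝕜 X = m)
    (hm : min (finrank 𝕜 X) (finrank 𝕜 Y) = m) (k : Fin m)
    (hmono : Monotone fun i => Real.sin (principalAngles X Y hm i)) :
    ∑ i, max ((projectionDifference_isSymmetric X Y).eigenvalues rfl i -
        Real.sin (principalAngles X Y hm k.rev)) 0 ≤
      ∑ j ∈ Finset.Iic k, (Real.sin (principalAngles X Y hm j.rev) -
        Real.sin (principalAngles X Y hm k.rev)) := by
  set μ := (projectionDifference_isSymmetric X Y).eigenvalues rfl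
  set σ := fun i => Real.sin (principalAngles X Y hm i) with hσ
  have hσ0 : ∀ i, 0 ≤ σ i := fun i => Real.sin_nonneg_of_nonneg_of_le_pi
    (Real.arccos_nonneg _) (Real.arccos_le_pi _)
  have hmn : m ≤ finrank 𝕜 H := hX ▸ X.finrank_le
  have hle : ∀ j : Fin m, μ (Fin.castLE hmn j) ≤ σ j.rev := by
    intro j
    rcases le_or_gt (μ (Fin.castLE hmn j)) 0 with h | h
    · exact h.trans (hσ0 _)
    -- Cosines decrease with the index, so the `j`-th largest sine sits at `j.rev`, and `j.rev + j +
    -- 1 = m`.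
    · have h1 := sq_singularValues_le X Y rfl h (i := (j.rev : Fin m)) (by
        rw [hX, Fin.val_rev, Fin.val_castLE]
        omega)
      rw [hσ]
      simp only [principalAngles, Real.sin_arccos]
      refine Real.le_sqrt_of_sq_le ?_
      linarith
  -- Past index `k` every `μ i` is at most the threshold, so its positive part vanishes.
  have hsubset : ∑ i ∈ (Finset.Iic k).map (Fin.castLEEmb hmn), max (μ i - σ k.rev) 0 =
      ∑ i, max (μ i - σ k.rev) 0 := by
    refine Finset.sum_subset (Finset.subset_univ _) fun i _ hi => max_eq_right ?_
    rw [sub_nonpos]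
    by_cases him : (i : ℕ) < m
    · have hik : k ≤ (⟨i, him⟩ : Fin m) := by
        by_contra! hlt
        exact hi (Finset.mem_map.2 ⟨⟨i, him⟩, Finset.mem_Iic.2 hlt.le, rfl⟩)
      exact (hle ⟨i, him⟩).trans (hmono (Fin.rev_le_rev.2 hik))
    · exact (eigenvalues_projectionDifference_nonpos X Y rfl
        (by rw [hX]; exact not_lt.1 him)).trans (hσ0 _)
  refine hsubset.symm.trans_le ?_
  rw [Finset.sum_map]
  refine Finset.sum_le_sum fun j hj => max_le (sub_le_sub_right (hle j) _) ?_
  exact sub_nonneg.2 (hmono (Fin.rev_le_rev.2 (Finset.mem_Iic.1 hj)))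

theorem sin_principalAngles_monotone (X Y : Submodule 𝕜 H) {m : ℕ}
    (hm : min (finrank 𝕜 X) (finrank 𝕜 Y) = m) :
    Monotone fun i => Real.sin (principalAngles X Y hm i) := by
  intro i j hij
  simp only [principalAngles, Real.sin_arccos]
  refine Real.sqrt_le_sqrt (sub_le_sub_left ?_ _)
  exact pow_le_pow_left₀ (LinearMap.singularValues_nonneg _ _)
    (LinearMap.singularValues_antitone _ (Fin.val_le_of_le hij)) 2

theorem sortDesc_of_monotone {n : ℕ} {x : Fin n → ℝ} (hx : Monotone x) (i : Fin n) :
    sortDesc x i = x i.rev := by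
  rw [sortDesc, Tuple.sort_eq_refl_iff_monotone.2 hx, Equiv.refl_apply]

end RitzMajorization

theorem theorem4p2 {𝕜 : Type*} [RCLike 𝕜] {H : Type*} [NormedAddCommGroup H]
    [InnerProductSpace 𝕜 H] [FiniteDimensional 𝕜 H]
    (A : H →ₗ[𝕜] H) (hA : A.IsSymmetric) (lambdaMin lambdaMax : ℝ)
    (hmin : IsLeast {μ : ℝ | Module.End.HasEigenvalue A (μ : 𝕜)} lambdaMin)
    (hmax : IsGreatest {μ : ℝ | Module.End.HasEigenvalue A (μ : 𝕜)} lambdaMax)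
    (X Y : Submodule 𝕜 H) {m : ℕ}
    (hX : Module.finrank 𝕜 X = m) (hY : Module.finrank 𝕜 Y = m) :
    RitzMajorization.WeaklyMajorizedBy
      (fun i => |RitzMajorization.ritzValues hA X hX i - RitzMajorization.ritzValues hA Y hY i|)
      (fun i => (lambdaMax - lambdaMin) *
        Real.sin (RitzMajorization.principalAngles X Y
          (show min (Module.finrank 𝕜 X) (Module.finrank 𝕜 Y) = m by rw [hX, hY, min_self]) i)) := by
  open RitzMajorization in
  intro k
  have hm : min (Module.finrank 𝕜 X) (Module.finrank 𝕜 Y) = m := by rw [hX, hY, min_self]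
  have hδ : lambdaMin ≤ lambdaMax := hmin.2 hmax.1
  have hmono := sin_principalAngles_monotone X Y hm
  have hl : ∀ x, lambdaMin * ‖x‖ ^ 2 ≤ RCLike.re (inner 𝕜 (A x) x) := fun x =>
    le_re_inner_of_mem_span (hA.apply_eigenvectorBasis rfl)
      (fun i _ => hmin.2 (hA.hasEigenvalue_eigenvalues rfl i)) (mem_span_basis_univ _ x)
  have hu : ∀ x, RCLike.re (inner 𝕜 (A x) x) ≤ lambdaMax * ‖x‖ ^ 2 := fun x =>
    re_inner_le_of_mem_span (hA.apply_eigenvectorBasis rfl)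
      (fun i _ => hmax.2 (hA.hasEigenvalue_eigenvalues rfl i)) (mem_span_basis_univ _ x)
  have ht : 0 ≤ Real.sin (principalAngles X Y hm k.rev) :=
    Real.sin_nonneg_of_nonneg_of_le_pi (Real.arccos_nonneg _) (Real.arccos_le_pi _)
  set d := fun i => |ritzValues hA X hX i - ritzValues hA Y hY i| with hd
  -- This is the permutation inside `sortDesc`; it sends `Finset.Iic k` to the positions of the `k +
  -- 1` largest entries.
  set π : Equiv.Perm (Fin m) := Fin.revPerm.trans (Tuple.sort d)
  have hleft : ∑ i ∈ Finset.Iic k, sortDesc d i =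
      ∑ i ∈ (Finset.Iic k).map π.toEmbedding, d i := by
    rw [Finset.sum_map]
    rfl
  -- Here `t` is the smallest of the `k + 1` largest sines; its multiple cancels against the one in
  -- `hE`.
  have h := sum_abs_ritzValues_sub_le hA hX hY ht hδ hl hu ((Finset.Iic k).map π.toEmbedding)
  have hE := sum_max_eigenvalues_sub_le X Y hX hm k hmono
  rw [hleft]
  refine h.trans ?_
  rw [Finset.card_map]
  rw [Finset.sum_sub_distrib, Finset.sum_const, nsmul_eq_mul] at hE
  rw [Finset.sum_congr rfl fun i _ => sortDesc_of_monotone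
    (hmono.const_mul (sub_nonneg.2 hδ)) i, ← Finset.mul_sum]
  refine mul_le_mul_of_nonneg_left ?_ (sub_nonneg.2 hδ)
  linarith
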